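/- Let $(\mathcal X,\mathcal A,P,r,\gamma)$ be a discounted Markov decision process: the state space $\mathcal X$ and the action space $\mathcal A$ are measurable spaces, the $\sigma$-algebra of $\mathcal A$ being countably generated (for instance, Borel subsets of Euclidean spaces), $P$ is a probability kernel from $\mathcal X\times\mathcal A$ to $\mathcal X$, the reward $r:\mathcal X\times\mathcal A\to\mathbb R$ is bounded and measurable, and $0\le\gamma<1$. Let $\pi$ (the policy) and $\pi^{\mathrm{ref}}$ (the reference policy) be probability kernels from $\mathcal X$ to $\mathcal A$, and let $\mathrm{KL}^\pi(x):=\mathrm{KL}(\pi_x\,\|\,\pi^{\mathrm{ref}}_x)\in[0,\infty]$. Let $P^\pi_{x,a}$ be the law of $(X',A')$ when $X'\sim P_{x,a}$ and, given $X'$, $A'\sim\pi_{X'}$. For $p\in[1,\infty)$ let $\mathcal K_p$ be the set of probability kernels $\zeta$ from $\mathcal X\times\mathcal A$ to $\mathbb R$ with $\sup_{x,a}\int|z|^p\,d\zeta_{x,a}(z)<\infty$, and let $\bar w_p(\zeta,\zeta'):=\sup_{x,a}w_p(\zeta_{x,a},\zeta'_{x,a})$, where $w_p$ is the $p$-Wasserstein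 distance on $\mathbb R$. For $\tau\ge 0$ the soft distributional Bellman operator $\mathcal T^\pi_\tau$ sends a probability kernel $\zeta$ to the kernel whose value $(\mathcal T^\pi_\tau\zeta)_{x,a}$ is the law of $$r(x,a)+\gamma Z-\gamma\tau\,\mathrm{KL}^\pi(X'),\qquad (X',A')\sim P^\pi_{x,a},\quad Z\mid(X',A')\sim\zeta_{X',A'} .$$ (Under the condition imposed next, $\tau\,\mathrm{KL}^\pi(X')$ is almost surely finite.) Let $p\in[1,\infty)$ and $\tau\ge0$ be such that $$\sup_{x,a}\big\|\tau\,\mathrm{KL}^\pi\big\|_{L^p(P_{x,a})}<\infty ,$$ with the convention $0\cdot\infty=0$ here and above (so the condition is void for $\tau=0$). Then: 1. $\mathcal T^\pi_\tau$ maps $\mathcal K_p$ to itself and is a $\gamma$-contraction in $\bar w_p$: $\bar w_p(\mathcal T^\pi_\tau\zeta,\mathcal T^\pi_\tau\zeta')\le\gamma\,\bar w_p(\zeta,\zeta')$ for all $\zeta,\zeta'\in\mathcal K_p$. 2. Let $(X_t,A_t)_{t\ge0}$ be the Markov chain with transition kernel $P^\pi$ started at $(X_0,A_0)=(x,a)$.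 For every $(x,a)$ the series $\sum_{t\ge1}\gamma^t\big(r(X_t,A_t)-\tau\,\mathrm{KL}^\pi(X_t)\big)$ converges absolutely almost surely, and the soft return distribution $$\zeta^{\pi}_{\tau}(x,a):=\mathrm{Law}\Big(r(X_0,A_0)+\sum_{t\ge1}\gamma^t\big(r(X_t,A_t)-\tau\,\mathrm{KL}^\pi(X_t)\big)\,\Big|\,X_0=x,\,A_0=a\Big)$$ belongs to $\mathcal K_p$ and is the unique $\zeta\in\mathcal K_p$ with $\mathcal T^\pi_\tau\zeta=\zeta$. -/

import Mathlib

open MeasureTheory ProbabilityTheory InformationTheory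
open scoped ENNReal

noncomputable section

/-! ### Kernels with bounded moments and the supremal Wasserstein metric -/

/-- The couplings of two measures on `ℝ`: measures on `ℝ × ℝ` with the given marginals. -/
def couplings (μ ν : Measure ℝ) : Set (Measure (ℝ × ℝ)) :=
  {ρ | ρ.map Prod.fst = μ ∧ ρ.map Prod.snd = ν}

/-- The `p`-Wasserstein distance of two probability measures on `ℝ`. -/
def wasserstein (p : ℝ) (μ ν : Measure ℝ) : ℝ≥0∞ :=
  (⨅ ρ ∈ couplings μ ν, ∫⁻ z, edist z.1 z.2 ^ p ∂ρ) ^ (1 / p)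

/-- The probability kernels `ζ` from `Y` to `ℝ` with `sup_y ∫ |z|^p dζ_y(z) < ∞`. -/
def momentKernels (Y : Type*) [MeasurableSpace Y] (p : ℝ) : Set (Kernel Y ℝ) :=
  {ζ | IsMarkovKernel ζ ∧ ⨆ y, ∫⁻ z, ‖z‖ₑ ^ p ∂(ζ y) < ∞}

/-- The supremal Wasserstein metric `sup_y W_p(ζ_y, ζ'_y)`. -/
def supWasserstein {Y : Type*} [MeasurableSpace Y] (p : ℝ) (ζ ζ' : Kernel Y ℝ) : ℝ≥0∞ :=
  ⨆ y, wasserstein p (ζ y) (ζ' y)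

/-! ### The decision process -/

/-- A Markov decision process with state space `X`, action space `A`, transition kernel `P`,
measurable reward `r` and discount factor `γ`. -/
structure DecisionProcess (X A : Type*) [MeasurableSpace X] [MeasurableSpace A] where
  P : Kernel (X × A) X
  isMarkovKernel_P : IsMarkovKernel P
  r : X × A → ℝ
  measurable_r : Measurable r
  γ : ℝ

attribute [instance] DecisionProcess.isMarkovKernel_P

/-- The Kullback-Leibler penalty `x ↦ KL(π_x ‖ πref_x)`, as an extended nonnegative function. -/
def klPenalty {X A : Type*} [MeasurableSpace X] [MeasurableSpace A] (π πref : Kernel X A)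
    (x : X) : ℝ≥0∞ :=
  klDiv (π x) (πref x)

theorem measurable_klPenalty {X A : Type*} [MeasurableSpace X] [MeasurableSpace A]
    [MeasurableSpace.CountablyGenerated A] (π πref : Kernel X A)
    [IsMarkovKernel π] [IsMarkovKernel πref] : Measurable (klPenalty π πref) := by
  classical
  have h : klPenalty π πref = fun x => if π x ≪ πref x then
      ∫⁻ a, ENNReal.ofReal (klFun (Kernel.rnDeriv π πref x a).toReal) ∂(πref x) else ∞ := by
    funext x
    rw [klPenalty, klDiv_eq_lintegral_klFun]
    congr 1
    apply lintegral_congr_ae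
    filter_upwards [Kernel.rnDeriv_eq_rnDeriv_measure (κ := π) (η := πref) (a := x)] with a ha
    rw [ha]
  rw [h]
  refine Measurable.ite (Kernel.measurableSet_absolutelyContinuous π πref) ?_ measurable_const
  refine Measurable.lintegral_kernel_prod_right
    (f := fun x a => ENNReal.ofReal (klFun (Kernel.rnDeriv π πref x a).toReal)) ?_
  exact (measurable_klFun.comp (Kernel.measurable_rnDeriv π πref).ennreal_toReal).ennreal_ofReal

namespace DecisionProcess

variable {X A : Type*} [MeasurableSpace X] [MeasurableSpace A]

/-- The state-action transition kernel of a policy `π`: from `(x, a)`, draw the next state `x'`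
from `P_{x,a}`, then the next action `a'` from `π_{x'}`. -/
def stateActionKernel (M : DecisionProcess X A) (π : Kernel X A) : Kernel (X × A) (X × A) :=
  M.P ⊗ₖ Kernel.prodMkLeft (X × A) π

instance (M : DecisionProcess X A) (π : Kernel X A) [IsMarkovKernel π] :
    IsMarkovKernel (M.stateActionKernel π) := by
  unfold stateActionKernel; infer_instance

/-- The law, on `ℕ → X × A`, of the state-action process `(X_t, A_t)_{t ≥ 0}` of the policy `π`
started at `(X_0, A_0) = (x, a)`: the Markov chain with kernel `stateActionKernel`. -/
def trajectory (M : DecisionProcess X A) (π : Kernel X A) [IsMarkovKernel π] :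
    Kernel (X × A) (ℕ → X × A) :=
  (Kernel.traj (X := fun _ => X × A)
    (fun n => (M.stateActionKernel π).comap
      (fun h : (i : Finset.Iic n) → X × A => h ⟨n, Finset.mem_Iic.2 le_rfl⟩)
      (measurable_pi_apply _)) 0).comap
    (fun xa _ => xa) (measurable_pi_lambda _ fun _ => measurable_id)

variable [MeasurableSpace.CountablyGenerated A]

/-- The soft distributional Bellman operator: `(T ζ)_{x,a}` is the law of
`r(x, a) + γ Z - γ τ KL(π_{X'} ‖ πref_{X'})`, where `(X', A')` is drawn from the state-action
kernel at `(x, a)` and then `Z` from `ζ_{X', A'}`. -/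
def softBellman (M : DecisionProcess X A) (π πref : Kernel X A) [IsMarkovKernel π]
    [IsMarkovKernel πref] (τ : ℝ) (ζ : Kernel (X × A) ℝ) : Kernel (X × A) ℝ where
  toFun xa :=
    ((M.stateActionKernel π ⊗ₖ Kernel.prodMkLeft (X × A) ζ) xa).map
      (fun y : (X × A) × ℝ =>
        M.r xa + M.γ * y.2 - M.γ * τ * (klPenalty π πref y.1.1).toReal)
  measurable' := by
    have hkl := measurable_klPenalty π πref
    have hr := M.measurable_r
    have hg : Measurable (fun w : (X × A) × ((X × A) × ℝ) =>
        M.r w.1 + M.γ * w.2.2 - M.γ * τ * (klPenalty π πref w.2.1.1).toReal) := by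
      fun_prop
    refine Measure.measurable_of_measurable_coe _ fun s hs => ?_
    have key := Kernel.measurable_kernel_prodMk_left
      (κ := M.stateActionKernel π ⊗ₖ Kernel.prodMkLeft (X × A) ζ) (hg hs)
    convert! key using 2 with xa
    exact Measure.map_apply (hg.comp measurable_prodMk_left) hs

/-- The term `γ^(t+1) (r(X_{t+1}, A_{t+1}) - τ KL(π_{X_{t+1}} ‖ πref_{X_{t+1}}))` of the soft
return along a trajectory `ω`. -/
def softReturnTerm (M : DecisionProcess X A) (π πref : Kernel X A) (τ : ℝ) (ω : ℕ → X × A)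
    (t : ℕ) : ℝ :=
  M.γ ^ (t + 1) * (M.r (ω (t + 1)) - τ * (klPenalty π πref (ω (t + 1)).1).toReal)

/-- The soft return along a trajectory `ω`; the penalty is not charged at time `0`. -/
def softReturn (M : DecisionProcess X A) (π πref : Kernel X A) (τ : ℝ) (ω : ℕ → X × A) : ℝ :=
  M.r (ω 0) + ∑' t, M.softReturnTerm π πref τ ω t

/-- The next definition pushes a kernel forward by `softReturn`, which requires measurability. -/
theorem measurable_softReturn (M : DecisionProcess X A) (π πref : Kernel X A)
    [IsMarkovKernel π] [IsMarkovKernel πref] (τ : ℝ) :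
    Measurable (M.softReturn π πref τ) := by
  have hkl := measurable_klPenalty π πref
  have hr := M.measurable_r
  unfold softReturn softReturnTerm
  refine (by fun_prop : Measurable fun ω : ℕ → X × A => M.r (ω 0)).add (Measurable.tsum ?_)
  intro t
  fun_prop

/-- The soft return distribution function: the conditional law of the soft return given
`(X_0, A_0) = (x, a)`. -/
def softReturnDistribution (M : DecisionProcess X A) (π πref : Kernel X A) [IsMarkovKernel π]
    [IsMarkovKernel πref] (τ : ℝ) : Kernel (X × A) ℝ :=
  (M.trajectory π).map (M.softReturn π πref τ)

end DecisionProcess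

end

/-!
On the real line the optimal coupling for the cost `|x - y| ^ p` is the quantile coupling: it gives
every set `{x ≤ u, y > v}` the least mass that its marginals allow, and `max (y - x) 0 ^ p` is the
mass, under a fixed measure of points `(u, v)`, of those with `x ≤ u` and `v < y`. The Wasserstein
distance of two laws is therefore the `L^p` distance of their quantile functions. As quantile
functions depend measurably on the law, this couples two kernels optimally at all points at once,
and a common reward and penalty cancel in the difference; what remains is the factor `γ`.

Conditionally on the pair `(X_t, A_t)`, the net reward at time `t + 1` has `L^p` norm bounded
uniformly in `t`, so the soft return is dominated in `L^p` by a geometric series. Splitting off its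
first term and applying the Markov property at time `1` gives the fixed point equation, and the
contraction makes the fixed point unique, because `supWasserstein` is finite on `momentKernels`.
-/

noncomputable section

/-! ### Quantile functions -/

/-- The uniform distribution on the open unit interval. It lives on the subtype because quantile
functions are meaningless outside of it. -/
def unitUniform : Measure (Set.Ioo (0 : ℝ) 1) := volume.comap Subtype.val

theorem unitUniform_coe_mem_Ioc {a b : ℝ} (ha : 0 ≤ a) (hb : b ≤ 1) :
    unitUniform {t | (t : ℝ) ∈ Set.Ioc a b} = ENNReal.ofReal (b - a) := by
  have hmap := map_comap_subtype_coe (measurableSet_Ioo (a := (0 : ℝ)) (b := 1)) volume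
  calc unitUniform {t | (t : ℝ) ∈ Set.Ioc a b} = unitUniform.map Subtype.val (Set.Ioc a b) :=
        (Measure.map_apply measurable_subtype_coe measurableSet_Ioc).symm
    _ = volume (Set.Ioc a b ∩ Set.Ioc 0 1) := by
        rw [unitUniform, hmap, restrict_Ioo_eq_restrict_Ioc,
          Measure.restrict_apply measurableSet_Ioc]
    _ = ENNReal.ofReal (b - a) := by
        rw [Set.inter_eq_left.2 (Set.Ioc_subset_Ioc ha hb), Real.volume_Ioc]

instance isProbabilityMeasure_unitUniform : IsProbabilityMeasure unitUniform := by
  have huniv : {t : Set.Ioo (0 : ℝ) 1 | (t : ℝ) ∈ Set.Ioc 0 1} = Set.univ :=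
    Set.eq_univ_of_forall fun t => ⟨t.2.1, t.2.2.le⟩
  exact ⟨by
    rw [← huniv, unitUniform_coe_mem_Ioc le_rfl le_rfl, sub_zero, ENNReal.ofReal_one]⟩

/-- The quantile function of a probability measure on `ℝ`, the left-continuous inverse of its
distribution function. It is defined on the open interval `(0, 1)` only, where the infimum is that
of a nonempty set that is bounded below. -/
def quantile (μ : Measure ℝ) (t : Set.Ioo (0 : ℝ) 1) : ℝ := sInf {x | (t : ℝ) ≤ cdf μ x}

theorem quantile_le_iff (μ : Measure ℝ) (t : Set.Ioo (0 : ℝ) 1) (x : ℝ) :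
    quantile μ t ≤ x ↔ (t : ℝ) ≤ cdf μ x := by
  obtain ⟨t, ht0, ht1⟩ := t
  have hne : {x | t ≤ cdf μ x}.Nonempty :=
    ((tendsto_cdf_atTop μ).eventually_const_le ht1).exists
  have hbdd : BddBelow {x | t ≤ cdf μ x} := by
    obtain ⟨b, hb⟩ := ((tendsto_cdf_atBot μ).eventually_lt_const ht0).exists
    exact ⟨b, fun y hy => ((monotone_cdf μ).reflect_lt (hb.trans_le hy)).le⟩
  refine ⟨fun h => ?_, fun h => csInf_le hbdd h⟩
  have hright : Filter.Tendsto (cdf μ) (nhdsWithin x (Set.Ioi x)) (nhds (cdf μ x)) :=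
    ((cdf μ).right_continuous x).tendsto.mono_left (nhdsWithin_mono x Set.Ioi_subset_Ici_self)
  refine ge_of_tendsto hright ?_
  filter_upwards [self_mem_nhdsWithin] with y hy
  obtain ⟨z, hz, hzy⟩ := exists_lt_of_csInf_lt hne (lt_of_le_of_lt h hy)
  exact le_trans hz (monotone_cdf μ hzy.le)

theorem lt_quantile_iff (μ : Measure ℝ) (t : Set.Ioo (0 : ℝ) 1) (x : ℝ) :
    x < quantile μ t ↔ cdf μ x < t := by
  rw [← not_le, quantile_le_iff, not_le]

theorem measurable_quantile_kernel {Y : Type*} [MeasurableSpace Y] (ζ : Kernel Y ℝ)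
    [IsMarkovKernel ζ] :
    Measurable fun w : Y × Set.Ioo (0 : ℝ) 1 => quantile (ζ w.1) w.2 := by
  refine measurable_of_Iic fun x => ?_
  have hpreimage : (fun w : Y × Set.Ioo (0 : ℝ) 1 => quantile (ζ w.1) w.2) ⁻¹' Set.Iic x =
      {w | (w.2 : ℝ) ≤ (ζ w.1 (Set.Iic x)).toReal} := by
    ext w
    rw [Set.mem_preimage, Set.mem_Iic, quantile_le_iff, cdf_eq_real]
    rfl
  rw [hpreimage]
  exact measurableSet_le (measurable_subtype_coe.comp measurable_snd)
    ((ζ.measurable_coe measurableSet_Iic).comp measurable_fst).ennreal_toReal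

theorem measurable_quantile (μ : Measure ℝ) [IsProbabilityMeasure μ] :
    Measurable (quantile μ) :=
  (measurable_quantile_kernel (Kernel.const Unit μ)).comp (measurable_prodMk_left (x := ()))

theorem map_quantile (μ : Measure ℝ) [IsProbabilityMeasure μ] :
    unitUniform.map (quantile μ) = μ := by
  have := Measure.isProbabilityMeasure_map (μ := unitUniform)
    (measurable_quantile μ).aemeasurable
  refine Measure.ext_of_Iic _ _ fun x => ?_
  have hpreimage : quantile μ ⁻¹' Set.Iic x =
      {t : Set.Ioo (0 : ℝ) 1 | (t : ℝ) ∈ Set.Ioc 0 (cdf μ x)} := by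
    ext t
    rw [Set.mem_preimage, Set.mem_Iic, quantile_le_iff]
    exact (and_iff_right t.2.1).symm
  rw [Measure.map_apply (measurable_quantile μ) measurableSet_Iic, hpreimage,
    unitUniform_coe_mem_Ioc le_rfl (cdf_le_one μ x), sub_zero, ofReal_cdf]

/-! ### Optimality of the quantile coupling -/

/-- The coupling of two probability measures on `ℝ` by their quantile functions; it is the optimal
one for every convex cost. -/
def quantileCoupling (μ ν : Measure ℝ) : Measure (ℝ × ℝ) :=
  unitUniform.map fun t => (quantile μ t, quantile ν t)

section QuantileCoupling

variable {μ ν : Measure ℝ} {ρ : Measure (ℝ × ℝ)}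

theorem swap_mem_couplings (hρ : ρ ∈ couplings μ ν) : ρ.map Prod.swap ∈ couplings ν μ :=
  ⟨(Measure.map_map measurable_fst measurable_swap).trans hρ.2,
    (Measure.map_map measurable_snd measurable_swap).trans hρ.1⟩

theorem isProbabilityMeasure_of_mem_couplings [IsProbabilityMeasure μ]
    (hρ : ρ ∈ couplings μ ν) : IsProbabilityMeasure ρ :=
  (Measure.isProbabilityMeasure_map_iff measurable_fst.aemeasurable).1 (hρ.1 ▸ inferInstance)

theorem ofReal_cdf_sub_cdf_le_of_mem_couplings [IsProbabilityMeasure μ] [IsProbabilityMeasure ν]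
    (hρ : ρ ∈ couplings μ ν) (u v : ℝ) :
    ENNReal.ofReal (cdf μ u - cdf ν v) ≤ ρ (Set.Iic u ×ˢ Set.Ioi v) := by
  have hcover : Prod.fst ⁻¹' Set.Iic u ⊆ Set.Iic u ×ˢ Set.Ioi v ∪ Prod.snd ⁻¹' Set.Iic v :=
    fun z hz => (lt_or_ge v z.2).imp (fun h => ⟨hz, h⟩) id
  rw [ENNReal.ofReal_sub _ (cdf_nonneg _ _), ofReal_cdf, ofReal_cdf, tsub_le_iff_right]
  calc μ (Set.Iic u) = ρ (Prod.fst ⁻¹' Set.Iic u) := by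
        rw [← Measure.map_apply measurable_fst measurableSet_Iic, hρ.1]
    _ ≤ ρ (Set.Iic u ×ˢ Set.Ioi v) + ρ (Prod.snd ⁻¹' Set.Iic v) :=
        (measure_mono hcover).trans (measure_union_le _ _)
    _ = ρ (Set.Iic u ×ˢ Set.Ioi v) + ν (Set.Iic v) := by
        rw [← Measure.map_apply measurable_snd measurableSet_Iic, hρ.2]

variable (μ ν) [IsProbabilityMeasure μ] [IsProbabilityMeasure ν]

theorem quantileCoupling_mem_couplings : quantileCoupling μ ν ∈ couplings μ ν := by
  have h := (measurable_quantile μ).prodMk (measurable_quantile ν)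
  exact ⟨(Measure.map_map measurable_fst h).trans (map_quantile μ),
    (Measure.map_map measurable_snd h).trans (map_quantile ν)⟩

theorem map_swap_quantileCoupling :
    (quantileCoupling μ ν).map Prod.swap = quantileCoupling ν μ :=
  Measure.map_map measurable_swap ((measurable_quantile μ).prodMk (measurable_quantile ν))

theorem quantileCoupling_Iic_prod_Ioi (u v : ℝ) :
    quantileCoupling μ ν (Set.Iic u ×ˢ Set.Ioi v) = ENNReal.ofReal (cdf μ u - cdf ν v) := by
  have hpreimage : (fun t => (quantile μ t, quantile ν t)) ⁻¹' (Set.Iic u ×ˢ Set.Ioi v) =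
      {t : Set.Ioo (0 : ℝ) 1 | (t : ℝ) ∈ Set.Ioc (cdf ν v) (cdf μ u)} := by
    ext t
    exact (and_congr (quantile_le_iff μ t u) (lt_quantile_iff ν t v)).trans and_comm
  rw [quantileCoupling, Measure.map_apply ((measurable_quantile μ).prodMk (measurable_quantile ν))
    (measurableSet_Iic.prod measurableSet_Ioi), hpreimage,
    unitUniform_coe_mem_Ioc (cdf_nonneg ν v) (cdf_le_one μ u)]

end QuantileCoupling

section PowerMixture

variable {p : ℝ}

theorem ofReal_mul_setLIntegral_Ioc_rpow (hp : 0 < p) (z : ℝ) :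
    ENNReal.ofReal p * ∫⁻ s in Set.Ioc 0 z, ENNReal.ofReal (s ^ (p - 1)) =
      ENNReal.ofReal z ^ p := by
  rcases le_total z 0 with hz | hz
  · rw [Set.Ioc_eq_empty (not_lt.2 hz), setLIntegral_empty, mul_zero,
      ENNReal.ofReal_of_nonpos hz, ENNReal.zero_rpow_of_pos hp]
  have hint : IntervalIntegrable (fun s : ℝ => s ^ (p - 1)) volume 0 z :=
    intervalIntegral.intervalIntegrable_rpow' (by linarith)
  rw [← ofReal_integral_eq_lintegral_ofReal
      ((intervalIntegrable_iff_integrableOn_Ioc_of_le hz).1 hint)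
      ((ae_restrict_mem measurableSet_Ioc).mono fun s hs => Real.rpow_nonneg hs.1.le _),
    ← intervalIntegral.integral_of_le hz, integral_rpow (Or.inl (by linarith)), sub_add_cancel,
    Real.zero_rpow hp.ne', sub_zero, ENNReal.ofReal_rpow_of_nonneg hz hp.le,
    ← ENNReal.ofReal_mul hp.le, mul_div_cancel₀ _ hp.ne']

theorem ofReal_rpow_eq_setLIntegral (hp : 1 < p) (z : ℝ) :
    ENNReal.ofReal z ^ p = ENNReal.ofReal (p * (p - 1)) *
      ∫⁻ s in Set.Ioi 0, ENNReal.ofReal (s ^ (p - 2)) * ENNReal.ofReal (z - s) := by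
  have hmeas : ∀ t ∈ Set.Ioi (0 : ℝ),
      volume.restrict (Set.Ioc 0 z) {s | t ≤ s} = ENNReal.ofReal (z - t) := by
    intro t (ht : 0 < t)
    have hset : {s | t ≤ s} ∩ Set.Ioc 0 z = Set.Icc t z := by
      ext s
      exact ⟨fun h => ⟨h.1, h.2.2⟩, fun h => ⟨h.1, ht.trans_le h.1, h.2⟩⟩
    rw [Measure.restrict_apply' measurableSet_Ioc, hset, Real.volume_Icc]
  have hnonneg : 0 ≤ᵐ[volume.restrict (Set.Ioc 0 z)] fun s => s :=
    (ae_restrict_mem measurableSet_Ioc).mono fun s hs => hs.1.le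
  rw [← ofReal_mul_setLIntegral_Ioc_rpow (by linarith), ENNReal.ofReal_mul (by linarith),
    mul_assoc, lintegral_rpow_eq_lintegral_meas_le_mul _ hnonneg aemeasurable_id' (sub_pos.2 hp)]
  congr 2
  refine setLIntegral_congr_fun measurableSet_Ioi fun t ht => ?_
  rw [hmeas t ht, mul_comm]
  ring_nf

theorem exists_lintegral_ofReal_sub_eq_rpow (hp : 1 ≤ p) :
    ∃ ν : Measure ℝ, SFinite ν ∧
      ∀ z, ∫⁻ s, ENNReal.ofReal (z - s) ∂ν = ENNReal.ofReal z ^ p := by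
  rcases hp.eq_or_lt with rfl | hp
  · exact ⟨Measure.dirac 0, inferInstance, fun z => by simp⟩
  refine ⟨ENNReal.ofReal (p * (p - 1)) • (volume.restrict (Set.Ioi 0)).withDensity
    fun s => ENNReal.ofReal (s ^ (p - 2)), inferInstance, fun z => ?_⟩
  rw [ofReal_rpow_eq_setLIntegral hp, lintegral_smul_measure,
    lintegral_withDensity_eq_lintegral_mul _ (by fun_prop) (by fun_prop)]
  rfl

theorem exists_measure_Ici_prod_Iio_eq_rpow (hp : 1 ≤ p) :
    ∃ m : Measure (ℝ × ℝ), SFinite m ∧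
      ∀ x y, m (Set.Ici x ×ˢ Set.Iio y) = ENNReal.ofReal (y - x) ^ p := by
  obtain ⟨ν, _, hν⟩ := exists_lintegral_ofReal_sub_eq_rpow hp
  have hshift : Measurable fun w : ℝ × ℝ => (w.2, w.2 + w.1) := by fun_prop
  refine ⟨(ν.prod volume).map fun w => (w.2, w.2 + w.1), inferInstance, fun x y => ?_⟩
  have hrect : MeasurableSet (Set.Ici x ×ˢ Set.Iio y) := measurableSet_Ici.prod measurableSet_Iio
  rw [Measure.map_apply hshift hrect, Measure.prod_apply (hshift hrect), ← hν]
  refine lintegral_congr fun s => ?_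
  have hsection : Prod.mk s ⁻¹' ((fun w : ℝ × ℝ => (w.2, w.2 + w.1)) ⁻¹'
      Set.Ici x ×ˢ Set.Iio y) = Set.Ico x (y - s) := by
    ext u
    exact and_congr_right fun _ => (lt_sub_iff_add_lt (a := u)).symm
  rw [hsection, Real.volume_Ico, sub_right_comm]

theorem edist_rpow_eq_add (hp : 0 < p) (x y : ℝ) :
    edist x y ^ p = ENNReal.ofReal (y - x) ^ p + ENNReal.ofReal (x - y) ^ p := by
  wlog hxy : x ≤ y generalizing x y
  · rw [edist_comm, this y x (le_of_not_ge hxy), add_comm]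
  rw [ENNReal.ofReal_of_nonpos (sub_nonpos.2 hxy), ENNReal.zero_rpow_of_pos hp, add_zero,
    edist_comm, edist_dist, Real.dist_eq, abs_of_nonneg (sub_nonneg.2 hxy)]

variable {μ ν : Measure ℝ} [IsProbabilityMeasure μ] [IsProbabilityMeasure ν]
  {ρ : Measure (ℝ × ℝ)}

theorem lintegral_ofReal_sub_rpow_quantileCoupling_le (hp : 1 ≤ p) (hρ : ρ ∈ couplings μ ν) :
    ∫⁻ z, ENNReal.ofReal (z.2 - z.1) ^ p ∂quantileCoupling μ ν ≤
      ∫⁻ z, ENNReal.ofReal (z.2 - z.1) ^ p ∂ρ := by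
  obtain ⟨m, _, hm⟩ := exists_measure_Ici_prod_Iio_eq_rpow hp
  have hseparated : MeasurableSet {q : (ℝ × ℝ) × ℝ × ℝ | q.1.1 ≤ q.2.1 ∧ q.2.2 < q.1.2} :=
    (measurableSet_le measurable_fst.fst measurable_snd.fst).inter
      (measurableSet_lt measurable_snd.snd measurable_fst.snd)
  have hTonelli (σ : Measure (ℝ × ℝ)) [IsProbabilityMeasure σ] :
      ∫⁻ z, ENNReal.ofReal (z.2 - z.1) ^ p ∂σ = ∫⁻ w, σ (Set.Iic w.1 ×ˢ Set.Ioi w.2) ∂m := by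
    simp_rw [← hm]
    exact (Measure.prod_apply hseparated).symm.trans (Measure.prod_apply_symm hseparated)
  have := isProbabilityMeasure_of_mem_couplings hρ
  have := isProbabilityMeasure_of_mem_couplings (quantileCoupling_mem_couplings μ ν)
  rw [hTonelli, hTonelli]
  refine lintegral_mono fun w => ?_
  rw [quantileCoupling_Iic_prod_Ioi]
  exact ofReal_cdf_sub_cdf_le_of_mem_couplings hρ w.1 w.2

theorem lintegral_edist_rpow_quantileCoupling_le (hp : 1 ≤ p) (hρ : ρ ∈ couplings μ ν) :
    ∫⁻ z, edist z.1 z.2 ^ p ∂quantileCoupling μ ν ≤ ∫⁻ z, edist z.1 z.2 ^ p ∂ρ := by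
  have hsplit (σ : Measure (ℝ × ℝ)) : ∫⁻ z, edist z.1 z.2 ^ p ∂σ =
      ∫⁻ z, ENNReal.ofReal (z.2 - z.1) ^ p ∂σ +
        ∫⁻ z, ENNReal.ofReal (z.2 - z.1) ^ p ∂σ.map Prod.swap := by
    rw [lintegral_map (by fun_prop) measurable_swap, ← lintegral_add_left (by fun_prop)]
    exact lintegral_congr fun z => edist_rpow_eq_add (by linarith) z.1 z.2
  rw [hsplit, hsplit, map_swap_quantileCoupling]
  exact add_le_add (lintegral_ofReal_sub_rpow_quantileCoupling_le hp hρ)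
    (lintegral_ofReal_sub_rpow_quantileCoupling_le hp (swap_mem_couplings hρ))

end PowerMixture

/-! ### Wasserstein distances as `L^p` norms -/

section Mixture

variable {α β ε : Type*} [MeasurableSpace α] [MeasurableSpace β] [TopologicalSpace ε]
  [ContinuousENorm ε] {μ : Measure α} [IsProbabilityMeasure μ] {f : α × β → ε}
  {q C : ℝ≥0∞}

theorem eLpNorm_compProd_le_of_forall (κ : Kernel α β) [IsSFiniteKernel κ]
    (hf : StronglyMeasurable f) (hq : q ≠ ∞)
    (hC : ∀ a, eLpNorm (fun b => f (a, b)) q (κ a) ≤ C) : eLpNorm f q (μ ⊗ₘ κ) ≤ C := by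
  rcases eq_or_ne q 0 with rfl | hq0
  · simp
  have hqpos : 0 < q.toReal := ENNReal.toReal_pos hq0 hq
  simp only [eLpNorm_eq_lintegral_rpow_enorm_toReal hq0 hq, one_div,
    ENNReal.rpow_inv_le_iff hqpos] at hC ⊢
  rw [Measure.lintegral_compProd (hf.enorm.pow_const _)]
  calc ∫⁻ a, ∫⁻ b, ‖f (a, b)‖ₑ ^ q.toReal ∂κ a ∂μ ≤ ∫⁻ _, C ^ q.toReal ∂μ := lintegral_mono hC
    _ = C ^ q.toReal := by rw [lintegral_const, measure_univ, mul_one]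

theorem eLpNorm_prod_le_of_forall (ν : Measure β) [SFinite ν] (hf : StronglyMeasurable f)
    (hq : q ≠ ∞) (hC : ∀ a, eLpNorm (fun b => f (a, b)) q ν ≤ C) :
    eLpNorm f q (μ.prod ν) ≤ C := by
  rw [← Measure.compProd_const]
  exact eLpNorm_compProd_le_of_forall _ hf hq hC

end Mixture

section Wasserstein

variable {p : ℝ} {μ ν : Measure ℝ}

theorem eLpNorm_ofReal_eq_lintegral {Ω : Type*} [MeasurableSpace Ω] (hp : 0 < p) (f : Ω → ℝ)
    (P : Measure Ω) :
    eLpNorm f (ENNReal.ofReal p) P = (∫⁻ ω, ‖f ω‖ₑ ^ p ∂P) ^ (1 / p) := by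
  rw [eLpNorm_eq_lintegral_rpow_enorm_toReal (ENNReal.ofReal_pos.2 hp).ne' ENNReal.ofReal_ne_top,
    ENNReal.toReal_ofReal hp.le]

theorem wasserstein_map_map_le_eLpNorm {Ω : Type*} [MeasurableSpace Ω] {P : Measure Ω}
    {f g : Ω → ℝ} (hp : 0 < p) (hf : Measurable f) (hg : Measurable g) :
    wasserstein p (P.map f) (P.map g) ≤ eLpNorm (f - g) (ENNReal.ofReal p) P := by
  have hmem : P.map (fun ω => (f ω, g ω)) ∈ couplings (P.map f) (P.map g) :=
    ⟨Measure.map_map measurable_fst (hf.prodMk hg), Measure.map_map measurable_snd (hf.prodMk hg)⟩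
  rw [eLpNorm_ofReal_eq_lintegral hp]
  refine ENNReal.rpow_le_rpow ((iInf₂_le _ hmem).trans_eq ?_) (by positivity)
  simp_rw [lintegral_map (f := fun z : ℝ × ℝ => edist z.1 z.2 ^ p) (by fun_prop) (hf.prodMk hg),
    edist_eq_enorm_sub, Pi.sub_apply]

theorem wasserstein_eq_eLpNorm_quantile [IsProbabilityMeasure μ] [IsProbabilityMeasure ν]
    (hp : 1 ≤ p) :
    wasserstein p μ ν =
      eLpNorm (quantile μ - quantile ν) (ENNReal.ofReal p) unitUniform := by
  refine le_antisymm ?_ ?_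
  · conv_lhs => rw [← map_quantile μ, ← map_quantile ν]
    exact wasserstein_map_map_le_eLpNorm (by linarith) (measurable_quantile μ)
      (measurable_quantile ν)
  · rw [eLpNorm_ofReal_eq_lintegral (by linarith)]
    refine ENNReal.rpow_le_rpow (le_iInf₂ fun ρ hρ => ?_) (by positivity)
    refine le_of_eq_of_le ?_ (lintegral_edist_rpow_quantileCoupling_le hp hρ)
    simp_rw [quantileCoupling, lintegral_map (f := fun z : ℝ × ℝ => edist z.1 z.2 ^ p)
      (by fun_prop) ((measurable_quantile μ).prodMk (measurable_quantile ν)), edist_eq_enorm_sub,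
      Pi.sub_apply]

theorem eq_of_wasserstein_eq_zero [IsProbabilityMeasure μ] [IsProbabilityMeasure ν] (hp : 1 ≤ p)
    (h : wasserstein p μ ν = 0) : μ = ν := by
  rw [wasserstein_eq_eLpNorm_quantile hp, eLpNorm_eq_zero_iff
    ((measurable_quantile μ).sub (measurable_quantile ν)).aestronglyMeasurable
    (ENNReal.ofReal_pos.2 (by linarith)).ne'] at h
  rw [← map_quantile μ, ← map_quantile ν]
  exact Measure.map_congr (h.mono fun t ht => sub_eq_zero.1 ht)

theorem wasserstein_le_eLpNorm_add_eLpNorm [IsProbabilityMeasure μ] [IsProbabilityMeasure ν]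
    (hp : 1 ≤ p) :
    wasserstein p μ ν ≤ eLpNorm id (ENNReal.ofReal p) μ + eLpNorm id (ENNReal.ofReal p) ν := by
  have hnorm (σ : Measure ℝ) [IsProbabilityMeasure σ] :
      eLpNorm (quantile σ) (ENNReal.ofReal p) unitUniform = eLpNorm id (ENNReal.ofReal p) σ := by
    conv_rhs => rw [← map_quantile σ, eLpNorm_map_measure aestronglyMeasurable_id
      (measurable_quantile σ).aemeasurable, Function.id_comp]
  rw [wasserstein_eq_eLpNorm_quantile hp, ← hnorm μ, ← hnorm ν]
  exact eLpNorm_sub_le (measurable_quantile μ).aestronglyMeasurable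
    (measurable_quantile ν).aestronglyMeasurable (ENNReal.one_le_ofReal.2 hp)

end Wasserstein

section MomentKernels

variable {Y : Type*} [MeasurableSpace Y] {p : ℝ} {ζ ζ' : Kernel Y ℝ}

theorem mem_momentKernels_iff (hp : 0 < p) :
    ζ ∈ momentKernels Y p ↔
      IsMarkovKernel ζ ∧ ⨆ y, eLpNorm id (ENNReal.ofReal p) (ζ y) < ∞ := by
  have hsup : ⨆ y, eLpNorm id (ENNReal.ofReal p) (ζ y) =
      (⨆ y, ∫⁻ z, ‖z‖ₑ ^ p ∂ζ y) ^ (1 / p) := by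
    simp_rw [eLpNorm_ofReal_eq_lintegral hp, id]
    exact ((ENNReal.orderIsoRpow (1 / p) (by positivity)).map_iSup _).symm
  rw [hsup, ENNReal.rpow_lt_top_iff_of_pos (by positivity)]
  rfl

theorem supWasserstein_lt_top (hp : 1 ≤ p) (hζ : ζ ∈ momentKernels Y p)
    (hζ' : ζ' ∈ momentKernels Y p) : supWasserstein p ζ ζ' < ∞ := by
  obtain ⟨_, hζ⟩ := (mem_momentKernels_iff (by linarith)).1 hζ
  obtain ⟨_, hζ'⟩ := (mem_momentKernels_iff (by linarith)).1 hζ'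
  refine (iSup_le fun y => ?_).trans_lt (ENNReal.add_lt_top.2 ⟨hζ, hζ'⟩)
  exact (wasserstein_le_eLpNorm_add_eLpNorm hp).trans
    (add_le_add (le_iSup (fun y => eLpNorm id (ENNReal.ofReal p) (ζ y)) y)
      (le_iSup (fun y => eLpNorm id (ENNReal.ofReal p) (ζ' y)) y))

theorem eq_of_supWasserstein_le_mul (hp : 1 ≤ p) (hζ : ζ ∈ momentKernels Y p)
    (hζ' : ζ' ∈ momentKernels Y p) {c : ℝ≥0∞} (hc : c < 1)
    (h : supWasserstein p ζ ζ' ≤ c * supWasserstein p ζ ζ') : ζ = ζ' := by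
  have hzero : supWasserstein p ζ ζ' = 0 := by
    by_contra hne
    have hlt := ENNReal.mul_lt_mul_left hne (supWasserstein_lt_top hp hζ hζ').ne hc
    exact (h.trans_lt (by simpa only [one_mul] using hlt)).false
  have := hζ.1
  have := hζ'.1
  exact Kernel.ext fun y => eq_of_wasserstein_eq_zero hp (ENNReal.iSup_eq_zero.1 hzero y)

theorem map_quantile_prod_unitUniform (μ : Measure Y) [SFinite μ] (ζ : Kernel Y ℝ)
    [IsMarkovKernel ζ] :
    (μ.prod unitUniform).map (fun w => (w.1, quantile (ζ w.1) w.2)) = μ ⊗ₘ ζ := by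
  have hq : Measurable fun w : Y × Set.Ioo (0 : ℝ) 1 => (w.1, quantile (ζ w.1) w.2) :=
    measurable_fst.prodMk (measurable_quantile_kernel ζ)
  ext s hs
  rw [Measure.map_apply hq hs, Measure.prod_apply (hq hs), Measure.compProd_apply hs]
  refine lintegral_congr fun y => ?_
  conv_rhs => rw [← map_quantile (ζ y), Measure.map_apply (measurable_quantile _)
    (measurable_prodMk_left hs)]
  rfl

variable (μ : Measure Y) [IsProbabilityMeasure μ] [IsMarkovKernel ζ] [IsMarkovKernel ζ']
  {f : Y → ℝ} (c : ℝ)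

theorem eLpNorm_map_compProd_affine_le (hp : 1 ≤ p) (hf : Measurable f) :
    eLpNorm id (ENNReal.ofReal p) ((μ ⊗ₘ ζ).map fun w => f w.1 + c * w.2) ≤
      eLpNorm f (ENNReal.ofReal p) μ + ‖c‖ₑ * ⨆ y, eLpNorm id (ENNReal.ofReal p) (ζ y) := by
  have hfst : eLpNorm (fun w : Y × ℝ => f w.1) (ENNReal.ofReal p) (μ ⊗ₘ ζ) =
      eLpNorm f (ENNReal.ofReal p) μ := by
    conv_rhs => rw [← Measure.fst_compProd μ ζ, Measure.fst, eLpNorm_map_measure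
      hf.aestronglyMeasurable measurable_fst.aemeasurable]
    rfl
  have hsnd : eLpNorm (fun w : Y × ℝ => w.2) (ENNReal.ofReal p) (μ ⊗ₘ ζ) ≤
      ⨆ y, eLpNorm id (ENNReal.ofReal p) (ζ y) :=
    eLpNorm_compProd_le_of_forall ζ measurable_snd.stronglyMeasurable ENNReal.ofReal_ne_top
      fun y => le_iSup (fun y => eLpNorm id (ENNReal.ofReal p) (ζ y)) y
  rw [eLpNorm_map_measure aestronglyMeasurable_id (by fun_prop), Function.id_comp]
  calc eLpNorm ((fun w : Y × ℝ => f w.1) + c • fun w : Y × ℝ => w.2) (ENNReal.ofReal p) (μ ⊗ₘ ζ)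
      ≤ eLpNorm (fun w : Y × ℝ => f w.1) (ENNReal.ofReal p) (μ ⊗ₘ ζ) +
          eLpNorm (c • fun w : Y × ℝ => w.2) (ENNReal.ofReal p) (μ ⊗ₘ ζ) :=
        eLpNorm_add_le (hf.comp measurable_fst).aestronglyMeasurable
          (measurable_snd.const_smul c).aestronglyMeasurable (ENNReal.one_le_ofReal.2 hp)
    _ ≤ eLpNorm f (ENNReal.ofReal p) μ + ‖c‖ₑ * ⨆ y, eLpNorm id (ENNReal.ofReal p) (ζ y) := by
        rw [hfst, eLpNorm_const_smul]
        gcongr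

theorem wasserstein_map_compProd_affine_le (hp : 1 ≤ p) (hf : Measurable f) :
    wasserstein p ((μ ⊗ₘ ζ).map fun w => f w.1 + c * w.2)
      ((μ ⊗ₘ ζ').map fun w => f w.1 + c * w.2) ≤ ‖c‖ₑ * supWasserstein p ζ ζ' := by
  have hq := measurable_quantile_kernel ζ
  have hq' := measurable_quantile_kernel ζ'
  let Δ (w : Y × Set.Ioo (0 : ℝ) 1) : ℝ := quantile (ζ w.1) w.2 - quantile (ζ' w.1) w.2
  have hΔ (y : Y) : eLpNorm (fun t => Δ (y, t)) (ENNReal.ofReal p) unitUniform ≤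
      supWasserstein p ζ ζ' :=
    (wasserstein_eq_eLpNorm_quantile (μ := ζ y) (ν := ζ' y) hp).ge.trans
      (le_iSup (fun y => wasserstein p (ζ y) (ζ' y)) y)
  rw [← map_quantile_prod_unitUniform μ ζ, ← map_quantile_prod_unitUniform μ ζ',
    Measure.map_map (by fun_prop) (by fun_prop), Measure.map_map (by fun_prop) (by fun_prop)]
  calc _ ≤ eLpNorm (c • Δ) (ENNReal.ofReal p) (μ.prod unitUniform) :=
        (wasserstein_map_map_le_eLpNorm (by linarith) (by fun_prop) (by fun_prop)).trans_eq (by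
          congr 1
          ext w
          exact (add_sub_add_left_eq_sub _ _ _).trans (mul_sub _ _ _).symm)
    _ = ‖c‖ₑ * eLpNorm Δ (ENNReal.ofReal p) (μ.prod unitUniform) := eLpNorm_const_smul c _ _ _
    _ ≤ ‖c‖ₑ * supWasserstein p ζ ζ' := by
        gcongr
        exact eLpNorm_prod_le_of_forall _ (hq.sub hq').stronglyMeasurable ENNReal.ofReal_ne_top hΔ

end MomentKernels

/-! ### Markov chains -/

section MarkovChain

theorem map_compProd_comap {F G H : Type*} [MeasurableSpace F] [MeasurableSpace G]
    [MeasurableSpace H] (μ : Measure F) [SFinite μ] (κ : Kernel G H) [IsSFiniteKernel κ]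
    {f : F → G} (hf : Measurable f) :
    (μ ⊗ₘ κ.comap f hf).map (Prod.map f id) = μ.map f ⊗ₘ κ := by
  ext s hs
  rw [Measure.map_apply (hf.prodMap measurable_id) hs,
    Measure.compProd_apply (hf.prodMap measurable_id hs), Measure.compProd_apply hs,
    lintegral_map (Kernel.measurable_kernel_prodMk_left hs) hf]
  rfl

theorem ext_of_map_frestrictLe {X : ℕ → Type*} [∀ n, MeasurableSpace (X n)]
    {m m' : Measure (Π n, X n)} [IsFiniteMeasure m']
    (h : ∀ n, m.map (Preorder.frestrictLe n) = m'.map (Preorder.frestrictLe n)) : m = m' := by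
  refine IsProjectiveLimit.unique (P := fun I => m'.map I.restrict) (fun I => ?_) fun _ => rfl
  have hI : I ⊆ Finset.Iic (I.sup id) := I.subset_Iic_sup_id
  have hrestrict : I.restrict = Finset.restrict₂ (π := X) hI ∘ Preorder.frestrictLe (I.sup id) :=
    rfl
  rw [hrestrict, ← Measure.map_map (by fun_prop) (by fun_prop), h,
    Measure.map_map (by fun_prop) (by fun_prop), ← hrestrict]

variable {E : Type*} [MeasurableSpace E]

/-- The transition kernel `K`, read as a kernel on histories up to time `n`: only the last point
of the history matters. -/
def historyKernel (K : Kernel E E) (n : ℕ) : Kernel ((i : Finset.Iic n) → E) E :=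
  K.comap (fun h => h ⟨n, Finset.mem_Iic.2 le_rfl⟩) (measurable_pi_apply _)

instance (K : Kernel E E) [IsMarkovKernel K] (n : ℕ) : IsMarkovKernel (historyKernel K n) := by
  unfold historyKernel; infer_instance

/-- Measures on sequences under which `K` is the conditional law of each point given its past. The
law of the initial point is left free. -/
def IsMarkovChain (K : Kernel E E) (m : Measure (ℕ → E)) : Prop :=
  ∀ n, m.map (fun ω => (Preorder.frestrictLe (π := fun _ => E) n ω, ω (n + 1))) =
    m.map (Preorder.frestrictLe (π := fun _ => E) n) ⊗ₘ historyKernel K n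

/-- The law of the Markov chain with transition kernel `K`, as a function of its initial point. -/
def markovChain (K : Kernel E E) [IsMarkovKernel K] : Kernel E (ℕ → E) :=
  (Kernel.traj (X := fun _ => E) (historyKernel K) 0).comap (fun e _ => e)
    (measurable_pi_lambda _ fun _ => measurable_id)

instance (K : Kernel E E) [IsMarkovKernel K] : IsMarkovKernel (markovChain K) := by
  unfold markovChain; infer_instance

/-- The sequence `ω` without its initial point. -/
def shift (ω : ℕ → E) (n : ℕ) : E := ω (n + 1)

theorem measurable_shift : Measurable (shift (E := E)) := by
  unfold shift; fun_prop

theorem IsMarkovChain.ext {K : Kernel E E} {m m' : Measure (ℕ → E)} [IsFiniteMeasure m']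
    (hm : IsMarkovChain K m) (hm' : IsMarkovChain K m')
    (h0 : m.map (fun ω => ω 0) = m'.map fun ω => ω 0) : m = m' := by
  refine ext_of_map_frestrictLe fun n => ?_
  induction n with
  | zero =>
    have hfirst : Preorder.frestrictLe (π := fun _ => E) 0 = (fun e _ => e) ∘ fun ω => ω 0 := by
      funext ω ⟨i, hi⟩
      obtain rfl : i = 0 := by simpa using hi
      rfl
    rw [hfirst, ← Measure.map_map (by fun_prop) (by fun_prop), h0,
      Measure.map_map (by fun_prop) (by fun_prop)]
  | succ n ih =>
    let append (w : ((i : Finset.Iic n) → E) × E) (i : Finset.Iic (n + 1)) : E :=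
      if hi : (i : ℕ) ≤ n then w.1 ⟨i, Finset.mem_Iic.2 hi⟩ else w.2
    have happend : Measurable append := measurable_pi_lambda _ fun i => by
      by_cases hi : (i : ℕ) ≤ n <;> simp only [append, hi, dite_true, dite_false] <;> fun_prop
    have hsucc : Preorder.frestrictLe (π := fun _ => E) (n + 1) =
        append ∘ fun ω => (Preorder.frestrictLe n ω, ω (n + 1)) := by
      funext ω ⟨i, hi⟩
      rcases (Finset.mem_Iic.1 hi).lt_or_eq with hlt | rfl
      · simp [append, Nat.lt_succ_iff.1 hlt]
      · simp [append]
    rw [hsucc, ← Measure.map_map happend (by fun_prop), hm n, ih, ← hm' n,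
      Measure.map_map happend (by fun_prop)]

theorem IsMarkovChain.map_shift {K : Kernel E E} [IsMarkovKernel K] {m : Measure (ℕ → E)}
    [SFinite m] (hm : IsMarkovChain K m) : IsMarkovChain K (m.map shift) := by
  intro n
  let tail (h : (i : Finset.Iic (n + 1)) → E) (i : Finset.Iic n) : E :=
    h ⟨i + 1, Finset.mem_Iic.2 (Nat.succ_le_succ (Finset.mem_Iic.1 i.2))⟩
  have htail : Measurable tail := by fun_prop
  have hpath : Preorder.frestrictLe (π := fun _ => E) n ∘ shift =
      tail ∘ Preorder.frestrictLe (π := fun _ => E) (n + 1) := rfl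
  have hstep : (fun ω => (Preorder.frestrictLe (π := fun _ => E) n ω, ω (n + 1))) ∘ shift =
      Prod.map tail id ∘ fun ω => (Preorder.frestrictLe (π := fun _ => E) (n + 1) ω,
        ω (n + 1 + 1)) := rfl
  have hkernel : historyKernel K (n + 1) = (historyKernel K n).comap tail htail := rfl
  rw [Measure.map_map (by fun_prop) measurable_shift, hstep,
    ← Measure.map_map (htail.prodMap measurable_id) (by fun_prop), hm (n + 1), hkernel,
    map_compProd_comap, Measure.map_map (by fun_prop) (by fun_prop), ← hpath,
    ← Measure.map_map (by fun_prop) measurable_shift]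

theorem isMarkovChain_markovChain_comp (K : Kernel E E) [IsMarkovKernel K] (μ : Measure E)
    [IsProbabilityMeasure μ] : IsMarkovChain K (markovChain K ∘ₘ μ) := by
  have htraj : markovChain K ∘ₘ μ = Kernel.trajMeasure (X := fun _ => E) μ (historyKernel K) := by
    rw [Kernel.trajMeasure, markovChain, ← Kernel.comp_deterministic_eq_comap,
      ← Measure.comp_assoc, Measure.deterministic_comp_eq_map]
    rfl
  rw [htraj]
  exact fun n => Kernel.map_frestrictLe_trajMeasure_compProd_eq_map_trajMeasure.symm

theorem isMarkovChain_markovChain (K : Kernel E E) [IsMarkovKernel K] (e : E) :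
    IsMarkovChain K (markovChain K e) := by
  rw [← Measure.dirac_bind (markovChain K).measurable e]
  exact isMarkovChain_markovChain_comp K _

theorem map_zero_prodMk_markovChain (K : Kernel E E) [IsMarkovKernel K] (e : E) :
    (markovChain K e).map (fun ω => (ω 0, ω)) = (markovChain K e).map (Prod.mk e) := by
  refine Measure.ext_of_lintegral _ fun f hf => ?_
  have hzero : Measurable fun ω : ℕ → E => f (ω 0, ω) := by fun_prop
  have hconst : Measurable fun ω : ℕ → E => f (e, ω) := by fun_prop
  rw [lintegral_map hf (by fun_prop), lintegral_map hf (by fun_prop), markovChain,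
    Kernel.comap_apply, Kernel.lintegral_traj _ hzero, Kernel.lintegral_traj _ hconst]
  rfl

theorem map_zero_prodMk_markovChain_comp (K : Kernel E E) [IsMarkovKernel K] (μ : Measure E)
    [SFinite μ] : (markovChain K ∘ₘ μ).map (fun ω => (ω 0, ω)) = μ ⊗ₘ markovChain K := by
  rw [Measure.map_comp _ _ (by fun_prop), Measure.compProd_eq_comp_prod]
  congr with e : 1
  rw [Kernel.map_apply _ (by fun_prop), map_zero_prodMk_markovChain, Kernel.prod_apply,
    Kernel.id_apply, Measure.dirac_prod]

theorem markovChain_map_shift (K : Kernel E E) [IsMarkovKernel K] (e : E) :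
    (markovChain K e).map shift = markovChain K ∘ₘ K e := by
  refine (isMarkovChain_markovChain K e).map_shift.ext (isMarkovChain_markovChain_comp K _) ?_
  calc ((markovChain K e).map shift).map (fun ω => ω 0)
      = (markovChain K e).map (fun ω => ω 1) := Measure.map_map (by fun_prop) measurable_shift
    _ = K e := by
        rw [markovChain, Kernel.comap_apply, ← Kernel.map_apply _ (by fun_prop)]
        exact DFunLike.congr_fun (Kernel.map_traj_succ_self (X := fun _ => E)
          (κ := historyKernel K) (a := 0)) fun _ => e
    _ = ((markovChain K ∘ₘ K e).map (fun ω => (ω 0, ω))).fst := by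
        rw [map_zero_prodMk_markovChain_comp, Measure.fst_compProd]
    _ = (markovChain K ∘ₘ K e).map (fun ω => ω 0) := Measure.fst_map_prodMk (by fun_prop)

theorem map_one_prodMk_shift_markovChain (K : Kernel E E) [IsMarkovKernel K] (e : E) :
    (markovChain K e).map (fun ω => (ω 1, shift ω)) = K e ⊗ₘ markovChain K := by
  rw [← map_zero_prodMk_markovChain_comp, ← markovChain_map_shift,
    Measure.map_map (by fun_prop) measurable_shift]
  rfl

theorem IsMarkovChain.eLpNorm_comp_succ_le {K : Kernel E E} [IsMarkovKernel K]
    {m : Measure (ℕ → E)} [IsProbabilityMeasure m] (hm : IsMarkovChain K m) {g : E → ℝ}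
    (hg : Measurable g) {q D : ℝ≥0∞} (hq : q ≠ ∞) (hD : ∀ e, eLpNorm g q (K e) ≤ D) (t : ℕ) :
    eLpNorm (fun ω => g (ω (t + 1))) q m ≤ D := by
  have hlast : (fun ω : ℕ → E => g (ω (t + 1))) = (fun w => g w.2) ∘ fun ω =>
      (Preorder.frestrictLe (π := fun _ => E) t ω, ω (t + 1)) := rfl
  have hsnd : Measurable fun w : ((i : Finset.Iic t) → E) × E => g w.2 := hg.comp measurable_snd
  have : IsProbabilityMeasure (m.map (Preorder.frestrictLe (π := fun _ => E) t)) :=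
    Measure.isProbabilityMeasure_map (by fun_prop)
  rw [hlast, ← eLpNorm_map_measure hsnd.aestronglyMeasurable (by fun_prop), hm t]
  exact eLpNorm_compProd_le_of_forall _ hsnd.stronglyMeasurable hq fun h => hD _

end MarkovChain

/-! ### `L^p` bounds -/

theorem eLpNorm_le_ofReal_of_forall_norm_le {α F : Type*} [MeasurableSpace α]
    {μ : Measure α} [IsProbabilityMeasure μ] [NormedAddCommGroup F] {f : α → F} {C : ℝ}
    (hC : ∀ a, ‖f a‖ ≤ C) (q : ℝ≥0∞) : eLpNorm f q μ ≤ ENNReal.ofReal C := by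
  simpa only [measure_univ, ENNReal.one_rpow, one_mul] using
    eLpNorm_le_of_ae_bound (μ := μ) (p := q) (Filter.Eventually.of_forall hC)

section Series

variable {α : Type*} {mα : MeasurableSpace α} {μ : Measure α}

theorem eLpNorm_tsum_le {F : Type*} [NormedAddCommGroup F] [CompleteSpace F]
    {f : ℕ → α → F} {q : ℝ≥0∞} (hq : 1 ≤ q) (hf : ∀ n, AEStronglyMeasurable (f n) μ) :
    eLpNorm (fun a => ∑' n, f n a) q μ ≤ ∑' n, eLpNorm (f n) q μ := by
  rcases eq_or_ne (∑' n, eLpNorm (f n) q μ) ∞ with htop | hfin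
  · exact htop ▸ le_top
  have hlim : ∀ᵐ a ∂μ, Filter.Tendsto (fun n => (∑ i ∈ Finset.range n, f i) a) Filter.atTop
      (nhds (∑' n, f n a)) := by
    filter_upwards [summable_norm_of_tsum_eLpNorm_ne_top hq hf hfin] with a ha
    simpa only [Finset.sum_apply] using ha.of_norm.hasSum.tendsto_sum_nat
  have hpartial (n : ℕ) :
      eLpNorm (∑ i ∈ Finset.range n, f i) q μ ≤ ∑' n, eLpNorm (f n) q μ :=
    (eLpNorm_sum_le (fun i _ => hf i) hq).trans (ENNReal.sum_le_tsum _)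
  calc eLpNorm (fun a => ∑' n, f n a) q μ
      ≤ Filter.atTop.liminf fun n => eLpNorm (∑ i ∈ Finset.range n, f i) q μ :=
        Lp.eLpNorm_lim_le_liminf_eLpNorm
          (fun n => Finset.aestronglyMeasurable_sum _ fun i _ => hf i) _ hlim
    _ ≤ ∑' n, eLpNorm (f n) q μ :=
        Filter.liminf_le_of_le (h := fun b hb =>
          let ⟨n, hn⟩ := hb.exists
          hn.trans (hpartial n))

theorem tsum_pow_succ_mul_lt_top {c D : ℝ≥0∞} (hc : c < 1) (hD : D < ∞) :
    ∑' n : ℕ, c ^ (n + 1) * D < ∞ := by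
  rw [ENNReal.tsum_mul_right, ENNReal.tsum_geometric_add_one]
  exact ENNReal.mul_lt_top (ENNReal.mul_lt_top (hc.trans ENNReal.one_lt_top)
    (ENNReal.inv_lt_top.2 (tsub_pos_of_lt hc))) hD

end Series

/-! ### The soft Bellman operator and the soft return -/

namespace DecisionProcess

variable {X A : Type*} [MeasurableSpace X] [MeasurableSpace A] (M : DecisionProcess X A)
  (π πref : Kernel X A)

theorem trajectory_eq_markovChain [IsMarkovKernel π] :
    M.trajectory π = markovChain (M.stateActionKernel π) := rfl

instance [IsMarkovKernel π] : IsMarkovKernel (M.trajectory π) :=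
  inferInstanceAs (IsMarkovKernel (markovChain (M.stateActionKernel π)))

theorem map_fst_stateActionKernel [IsMarkovKernel π] (xa : X × A) :
    (M.stateActionKernel π xa).map Prod.fst = M.P xa := by
  rw [stateActionKernel, ← Kernel.map_apply _ measurable_fst, ← Kernel.fst_eq,
    Kernel.fst_compProd]

theorem softReturn_eq_of_summable (τ : ℝ) {ω : ℕ → X × A}
    (h : Summable (M.softReturnTerm π πref τ ω)) :
    M.softReturn π πref τ ω = M.r (ω 0) - M.γ * (τ * (klPenalty π πref (ω 1).1).toReal) +
      M.γ * M.softReturn π πref τ (shift ω) := by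
  have hsucc (t : ℕ) : M.softReturnTerm π πref τ ω (t + 1) =
      M.γ * M.softReturnTerm π πref τ (shift ω) t := by
    simp only [softReturnTerm, shift]; ring
  rw [softReturn, h.tsum_eq_zero_add, softReturn]
  simp only [hsucc, tsum_mul_left]
  simp only [softReturnTerm, shift]
  ring

/-- The supremum over state-action pairs of the `L^p` norm of the penalty `τ KL` at the next
state. -/
def supPenaltyNorm (p τ : ℝ) : ℝ≥0∞ :=
  ⨆ xa, eLpNorm (fun x' => ‖τ‖ₑ * klPenalty π πref x') (ENNReal.ofReal p) (M.P xa)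

variable [MeasurableSpace.CountablyGenerated A] [IsMarkovKernel π] [IsMarkovKernel πref]

theorem softBellman_apply (τ : ℝ) (ζ : Kernel (X × A) ℝ) [IsSFiniteKernel ζ] (xa : X × A) :
    M.softBellman π πref τ ζ xa = (M.stateActionKernel π xa ⊗ₘ ζ).map fun w =>
      (M.r xa - M.γ * (τ * (klPenalty π πref w.1.1).toReal)) + M.γ * w.2 := by
  have hcompProd : (M.stateActionKernel π ⊗ₖ Kernel.prodMkLeft (X × A) ζ) xa =
      M.stateActionKernel π xa ⊗ₘ ζ := Kernel.compProd_apply_eq_compProd_sectR _ _ _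
  rw [← hcompProd]
  refine congrArg (Measure.map · _) (funext fun w => ?_)
  ring

variable {p τ : ℝ}

theorem supWasserstein_softBellman_le (hp : 1 ≤ p) (ζ ζ' : Kernel (X × A) ℝ) [IsMarkovKernel ζ]
    [IsMarkovKernel ζ'] :
    supWasserstein p (M.softBellman π πref τ ζ) (M.softBellman π πref τ ζ') ≤
      ‖M.γ‖ₑ * supWasserstein p ζ ζ' := by
  have hkl := measurable_klPenalty π πref
  refine iSup_le fun xa => ?_
  rw [softBellman_apply, softBellman_apply]
  exact wasserstein_map_compProd_affine_le _ _ hp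
    (f := fun y : X × A => M.r xa - M.γ * (τ * (klPenalty π πref y.1).toReal)) (by fun_prop)

theorem softBellman_softReturnDistribution
    (hsum : ∀ xa, ∀ᵐ ω ∂(M.trajectory π xa), Summable (M.softReturnTerm π πref τ ω)) :
    M.softBellman π πref τ (M.softReturnDistribution π πref τ) =
      M.softReturnDistribution π πref τ := by
  have hS := measurable_softReturn M π πref τ
  have hkl := measurable_klPenalty π πref
  have hr := M.measurable_r
  have hshift := measurable_shift (E := X × A)
  have : IsMarkovKernel (M.softReturnDistribution π πref τ) := Kernel.IsMarkovKernel.map _ hS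
  let G (w : (X × A) × (ℕ → X × A)) : ℝ :=
    (M.r w.1 - M.γ * (τ * (klPenalty π πref (w.2 1).1).toReal)) +
      M.γ * M.softReturn π πref τ (shift w.2)
  have hG : Measurable G := by fun_prop
  ext1 xa
  calc M.softBellman π πref τ (M.softReturnDistribution π πref τ) xa
      = (M.trajectory π xa).map fun ω => G (xa, ω) := by
        rw [softBellman_apply, softReturnDistribution, Measure.compProd_map hS,
          trajectory_eq_markovChain, ← map_one_prodMk_shift_markovChain,
          Measure.map_map (by fun_prop) (by fun_prop), Measure.map_map (by fun_prop) (by fun_prop)]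
        rfl
    _ = ((M.trajectory π xa).map (Prod.mk xa)).map G :=
        (Measure.map_map hG measurable_prodMk_left).symm
    _ = ((M.trajectory π xa).map fun ω => (ω 0, ω)).map G := by
        rw [trajectory_eq_markovChain, map_zero_prodMk_markovChain]
    _ = (M.trajectory π xa).map fun ω => G (ω 0, ω) := Measure.map_map hG (by fun_prop)
    _ = (M.trajectory π xa).map (M.softReturn π πref τ) :=
        Measure.map_congr ((hsum xa).mono fun ω hω =>
          (M.softReturn_eq_of_summable π πref τ hω).symm)
    _ = M.softReturnDistribution π πref τ xa := (Kernel.map_apply _ hS xa).symm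

theorem eLpNorm_penalty_stateActionKernel_le (xa : X × A) :
    eLpNorm (fun y => τ * (klPenalty π πref y.1).toReal) (ENNReal.ofReal p)
      (M.stateActionKernel π xa) ≤ M.supPenaltyNorm π πref p τ := by
  have hkl := measurable_klPenalty π πref
  refine le_trans ?_ (le_iSup _ xa)
  rw [← M.map_fst_stateActionKernel π xa,
    eLpNorm_map_measure (hkl.const_mul _).aestronglyMeasurable (by fun_prop)]
  refine eLpNorm_mono_enorm fun y => ?_
  rw [enorm_mul, Real.enorm_of_nonneg ENNReal.toReal_nonneg, Function.comp_apply, enorm_eq_self]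
  gcongr
  exact ENNReal.ofReal_toReal_le

variable {C : ℝ}

theorem eLpNorm_sub_mul_penalty_le (hp : 1 ≤ p) {f : X × A → ℝ} (hf : Measurable f)
    (hC : ∀ y, |f y| ≤ C) (c : ℝ) (xa : X × A) :
    eLpNorm (fun y => f y - c * (τ * (klPenalty π πref y.1).toReal)) (ENNReal.ofReal p)
      (M.stateActionKernel π xa) ≤ ENNReal.ofReal C + ‖c‖ₑ * M.supPenaltyNorm π πref p τ := by
  have hkl := measurable_klPenalty π πref
  let penalty (y : X × A) : ℝ := τ * (klPenalty π πref y.1).toReal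
  have hpenalty : Measurable penalty := by fun_prop
  calc eLpNorm (f - c • penalty) (ENNReal.ofReal p) (M.stateActionKernel π xa)
      ≤ eLpNorm f (ENNReal.ofReal p) (M.stateActionKernel π xa) +
          eLpNorm (c • penalty) (ENNReal.ofReal p) (M.stateActionKernel π xa) :=
        eLpNorm_sub_le hf.aestronglyMeasurable (hpenalty.const_smul c).aestronglyMeasurable
          (ENNReal.one_le_ofReal.2 hp)
    _ ≤ ENNReal.ofReal C + ‖c‖ₑ * M.supPenaltyNorm π πref p τ := by
        rw [eLpNorm_const_smul]
        gcongr
        · exact eLpNorm_le_ofReal_of_forall_norm_le hC _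
        · exact M.eLpNorm_penalty_stateActionKernel_le π πref xa

theorem softBellman_mem_momentKernels (hp : 1 ≤ p) (hC : ∀ xa, |M.r xa| ≤ C)
    (hKL : M.supPenaltyNorm π πref p τ < ∞)
    {ζ : Kernel (X × A) ℝ} (hζ : ζ ∈ momentKernels (X × A) p) :
    M.softBellman π πref τ ζ ∈ momentKernels (X × A) p := by
  have hkl := measurable_klPenalty π πref
  rw [mem_momentKernels_iff (by linarith)] at hζ ⊢
  obtain ⟨_, hζ_top⟩ := hζ
  refine ⟨⟨fun xa => ?_⟩, ?_⟩
  · rw [softBellman_apply]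
    exact Measure.isProbabilityMeasure_map (by fun_prop)
  set Z := ⨆ y, eLpNorm id (ENNReal.ofReal p) (ζ y)
  have hbound (xa : X × A) : eLpNorm id (ENNReal.ofReal p) (M.softBellman π πref τ ζ xa) ≤
      ENNReal.ofReal C + ‖M.γ‖ₑ * M.supPenaltyNorm π πref p τ + ‖M.γ‖ₑ * Z := by
    rw [softBellman_apply]
    refine (eLpNorm_map_compProd_affine_le _ _ hp
      (f := fun y : X × A => M.r xa - M.γ * (τ * (klPenalty π πref y.1).toReal))
      (by fun_prop)).trans ?_
    gcongr
    exact M.eLpNorm_sub_mul_penalty_le π πref hp measurable_const (fun _ => hC xa) M.γ xa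
  exact (iSup_le hbound).trans_lt (by finiteness)

variable (τ) in
theorem measurable_softReturnTerm (t : ℕ) :
    Measurable fun ω => M.softReturnTerm π πref τ ω t := by
  have hkl := measurable_klPenalty π πref
  have hr := M.measurable_r
  unfold softReturnTerm
  fun_prop

theorem eLpNorm_softReturnTerm_le (hp : 1 ≤ p) (hC : ∀ xa, |M.r xa| ≤ C) (xa : X × A) (t : ℕ) :
    eLpNorm (fun ω => M.softReturnTerm π πref τ ω t) (ENNReal.ofReal p) (M.trajectory π xa) ≤
      ‖M.γ‖ₑ ^ (t + 1) * (ENNReal.ofReal C + M.supPenaltyNorm π πref p τ) := by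
  have hkl := measurable_klPenalty π πref
  have hr := M.measurable_r
  let g (y : X × A) : ℝ := M.r y - τ * (klPenalty π πref y.1).toReal
  have hg : Measurable g := by fun_prop
  have hstep (xa : X × A) : eLpNorm g (ENNReal.ofReal p) (M.stateActionKernel π xa) ≤
      ENNReal.ofReal C + M.supPenaltyNorm π πref p τ := by
    simpa only [one_mul, enorm_one] using
      M.eLpNorm_sub_mul_penalty_le π πref hp M.measurable_r hC 1 xa
  calc eLpNorm (M.γ ^ (t + 1) • fun ω => g (ω (t + 1))) (ENNReal.ofReal p) (M.trajectory π xa)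
      = ‖M.γ‖ₑ ^ (t + 1) *
          eLpNorm (fun ω => g (ω (t + 1))) (ENNReal.ofReal p) (M.trajectory π xa) := by
        rw [eLpNorm_const_smul, enorm_pow]
    _ ≤ ‖M.γ‖ₑ ^ (t + 1) * (ENNReal.ofReal C + M.supPenaltyNorm π πref p τ) := by
        gcongr
        exact (isMarkovChain_markovChain _ xa).eLpNorm_comp_succ_le hg ENNReal.ofReal_ne_top hstep t

theorem tsum_eLpNorm_softReturnTerm_le (hp : 1 ≤ p) (hC : ∀ xa, |M.r xa| ≤ C) (xa : X × A) :
    ∑' t, eLpNorm (fun ω => M.softReturnTerm π πref τ ω t) (ENNReal.ofReal p)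
      (M.trajectory π xa) ≤
        ∑' t : ℕ, ‖M.γ‖ₑ ^ (t + 1) * (ENNReal.ofReal C + M.supPenaltyNorm π πref p τ) :=
  ENNReal.tsum_le_tsum (M.eLpNorm_softReturnTerm_le π πref hp hC xa)

theorem ae_summable_softReturnTerm (hp : 1 ≤ p) (hC : ∀ xa, |M.r xa| ≤ C) (hγ : ‖M.γ‖ₑ < 1)
    (hKL : M.supPenaltyNorm π πref p τ < ∞) (xa : X × A) :
    ∀ᵐ ω ∂(M.trajectory π xa), Summable (M.softReturnTerm π πref τ ω) := by
  have hfin := (M.tsum_eLpNorm_softReturnTerm_le π πref hp hC xa).trans_lt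
    (tsum_pow_succ_mul_lt_top hγ (by finiteness))
  filter_upwards [summable_norm_of_tsum_eLpNorm_ne_top (ENNReal.one_le_ofReal.2 hp)
    (fun t => (M.measurable_softReturnTerm π πref τ t).aestronglyMeasurable) hfin.ne] with ω hω
  exact hω.of_norm

theorem softReturnDistribution_mem_momentKernels (hp : 1 ≤ p) (hC : ∀ xa, |M.r xa| ≤ C)
    (hγ : ‖M.γ‖ₑ < 1) (hKL : M.supPenaltyNorm π πref p τ < ∞) :
    M.softReturnDistribution π πref τ ∈ momentKernels (X × A) p := by
  have hS := measurable_softReturn M π πref τ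
  have hr := M.measurable_r
  have hterm := M.measurable_softReturnTerm π πref τ
  have hq : 1 ≤ ENNReal.ofReal p := ENNReal.one_le_ofReal.2 hp
  refine (mem_momentKernels_iff (by linarith)).2 ⟨Kernel.IsMarkovKernel.map _ hS, ?_⟩
  set D := ∑' t : ℕ, ‖M.γ‖ₑ ^ (t + 1) * (ENNReal.ofReal C + M.supPenaltyNorm π πref p τ)
  have hD : D < ∞ := tsum_pow_succ_mul_lt_top hγ (by finiteness)
  have hbound (xa : X × A) : eLpNorm id (ENNReal.ofReal p)
      (M.softReturnDistribution π πref τ xa) ≤ ENNReal.ofReal C + D := by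
    rw [softReturnDistribution, Kernel.map_apply _ hS,
      eLpNorm_map_measure aestronglyMeasurable_id hS.aemeasurable, Function.id_comp]
    calc eLpNorm (M.softReturn π πref τ) (ENNReal.ofReal p) (M.trajectory π xa)
        ≤ eLpNorm (fun ω => M.r (ω 0)) (ENNReal.ofReal p) (M.trajectory π xa) +
            eLpNorm (fun ω => ∑' t, M.softReturnTerm π πref τ ω t) (ENNReal.ofReal p)
              (M.trajectory π xa) :=
          eLpNorm_add_le (hr.comp (measurable_pi_apply 0)).aestronglyMeasurable
            (Measurable.tsum hterm).aestronglyMeasurable hq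
      _ ≤ ENNReal.ofReal C + D :=
          add_le_add (eLpNorm_le_ofReal_of_forall_norm_le (fun ω => hC (ω 0)) _)
            ((eLpNorm_tsum_le hq fun t => (hterm t).aestronglyMeasurable).trans
              (M.tsum_eLpNorm_softReturnTerm_le π πref hp hC xa))
  exact (iSup_le hbound).trans_lt (by finiteness)

end DecisionProcess

theorem mainTheorem8_general {X A : Type*} [MeasurableSpace X] [MeasurableSpace A]
    [MeasurableSpace.CountablyGenerated A] (M : DecisionProcess X A)
    (hr : ∃ C : ℝ, ∀ xa, |M.r xa| ≤ C) (hγ : |M.γ| < 1) (π πref : Kernel X A) [IsMarkovKernel π]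
    [IsMarkovKernel πref] (p : ℝ) (hp : 1 ≤ p) (τ : ℝ)
    (hkl : ⨆ xa, eLpNorm (fun x' => ‖τ‖ₑ * klPenalty π πref x') (ENNReal.ofReal p)
      (M.P xa) < ∞) :
    (∀ ζ ∈ momentKernels (X × A) p, M.softBellman π πref τ ζ ∈ momentKernels (X × A) p) ∧
    (∀ ζ ∈ momentKernels (X × A) p, ∀ ζ' ∈ momentKernels (X × A) p,
      supWasserstein p (M.softBellman π πref τ ζ) (M.softBellman π πref τ ζ') ≤
        ‖M.γ‖ₑ * supWasserstein p ζ ζ') ∧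
    (∀ xa, ∀ᵐ ω ∂(M.trajectory π xa), Summable (M.softReturnTerm π πref τ ω)) ∧
    M.softReturnDistribution π πref τ ∈ momentKernels (X × A) p ∧
    M.softBellman π πref τ (M.softReturnDistribution π πref τ) =
      M.softReturnDistribution π πref τ ∧
    (∀ ζ ∈ momentKernels (X × A) p,
      M.softBellman π πref τ ζ = ζ → ζ = M.softReturnDistribution π πref τ) := by
  obtain ⟨C, hC⟩ := hr
  have hγ' : ‖M.γ‖ₑ < 1 := by
    rwa [Real.enorm_eq_ofReal_abs, ENNReal.ofReal_lt_one]
  have hcontract (ζ) (hζ : ζ ∈ momentKernels (X × A) p) (ζ') (hζ' : ζ' ∈ momentKernels (X × A) p) :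
      supWasserstein p (M.softBellman π πref τ ζ) (M.softBellman π πref τ ζ') ≤
        ‖M.γ‖ₑ * supWasserstein p ζ ζ' :=
    have := hζ.1
    have := hζ'.1
    M.supWasserstein_softBellman_le π πref hp ζ ζ'
  have hsum := M.ae_summable_softReturnTerm π πref hp hC hγ' hkl
  have hmem := M.softReturnDistribution_mem_momentKernels π πref hp hC hγ' hkl
  have hfix := M.softBellman_softReturnDistribution π πref hsum
  refine ⟨fun ζ => M.softBellman_mem_momentKernels π πref hp hC hkl, hcontract, hsum, hmem,
    hfix, fun ζ hζ hζ_fix => eq_of_supWasserstein_le_mul hp hζ hmem hγ' ?_⟩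
  simpa only [hζ_fix, hfix] using hcontract ζ hζ _ hmem

end

theorem mainTheorem8 {X A : Type*} [MeasurableSpace X] [MeasurableSpace A]
    [MeasurableSpace.CountablyGenerated A]
    (M : DecisionProcess X A)
    (hr : ∃ C : ℝ, ∀ xa, |M.r xa| ≤ C) (hγ0 : 0 ≤ M.γ) (hγ1 : M.γ < 1)
    (π πref : Kernel X A) [IsMarkovKernel π] [IsMarkovKernel πref]
    (p : ℝ) (hp : 1 ≤ p) (τ : ℝ) (hτ : 0 ≤ τ)
    (hkl : ⨆ xa, eLpNorm (fun x' => ENNReal.ofReal τ * klPenalty π πref x')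
      (ENNReal.ofReal p) (M.P xa) < ∞) :
    -- the operator is a `γ`-contraction of the space of kernels with bounded `p`-th moments
    (∀ ζ ∈ momentKernels (X × A) p, M.softBellman π πref τ ζ ∈ momentKernels (X × A) p) ∧
    (∀ ζ ∈ momentKernels (X × A) p, ∀ ζ' ∈ momentKernels (X × A) p,
      supWasserstein p (M.softBellman π πref τ ζ) (M.softBellman π πref τ ζ') ≤
        ENNReal.ofReal M.γ * supWasserstein p ζ ζ') ∧
    -- the series that defines the soft return converges absolutely, almost surely
    (∀ xa, ∀ᵐ ω ∂(M.trajectory π xa), Summable (M.softReturnTerm π πref τ ω)) ∧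
    -- the soft return distribution function is the unique fixed point
    M.softReturnDistribution π πref τ ∈ momentKernels (X × A) p ∧
    M.softBellman π πref τ (M.softReturnDistribution π πref τ) =
      M.softReturnDistribution π πref τ ∧
    (∀ ζ ∈ momentKernels (X × A) p,
      M.softBellman π πref τ ζ = ζ → ζ = M.softReturnDistribution π πref τ) := by
  rw [← Real.enorm_of_nonneg hτ] at hkl
  rw [← Real.enorm_of_nonneg hγ0]
  exact mainTheorem8_general M hr (abs_lt.2 ⟨by linarith, hγ1⟩) π πref p hp τ hkl
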